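/- Let $d\ge 1$, let $\gamma_1,\dots,\gamma_d\in\mathbb R^d$ be linearly independent, let $\mathcal R=\gamma_1\mathbb Z\oplus\cdots\oplus\gamma_d\mathbb Z$, and put $\hat\gamma_j=\gamma_j/\|\gamma_j\|$. A function $f$ on $\mathbb R^d$ is $\mathcal R$-periodic if $f(\mathbf r+a)=f(\mathbf r)$ for all $a\in\mathcal R$, $\mathbf r\in\mathbb R^d$. Function classes. $C_p^0(\mathbb R)$ is the set of functions $f:\mathbb R\to\mathbb C$ that have only finitely many discontinuities on every bounded interval and are integrable there. For $l\ge 0$, $C_p^{l+1}(\mathbb R)$ is the set of continuous functions $\mathbb R\to\mathbb C$ that are differentiable, except possibly at finitely many points of every bounded interval, with derivative in $C_p^{l}(\mathbb R)$. A function $f:\mathbb R^d\to\mathbb C$ is in $\bigotimes_{j=1}^d C_p^l(\mathbb R)$ if for every $j$ and every $\mathbf r\in\mathbb R^d$ the function $t\mapsto f(\mathbf r+t\hat\gamma_j)$ is in $C_p^l(\mathbb R)$. Let $V\in\bigotimes_{j=1}^d C_p^0(\mathbb R)$ be $\mathcal R$-periodic (real or complex valued) and $\lambda\in\mathbb C$.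 Fix a Lebesgue null set $N\subset\mathbb R^d$, possibly empty, that is invariant under translations by $\mathcal R$. A solution of $$-\tfrac12\Delta\Psi+V\Psi=\lambda\Psi \qquad (*)$$ is a function $\Psi\in\bigotimes_{j=1}^d C_p^2(\mathbb R)$ that is twice differentiable and satisfies $(*)$ at every point of $\mathbb R^d\setminus N$ (so for $N=\emptyset$ the equation holds everywhere in the classical sense). A Bloch solution of $(*)$ with quasimomentum $\mathbf k\in\mathbb C^d$ is a solution of the form $\Psi(\mathbf r)=e^{\mathrm i\mathbf k\cdot\mathbf r}p(\mathbf r)$ with $p$ $\mathcal R$-periodic. A function $\Psi$ is separable if there are functions $\psi_1,\dots,\psi_d:\mathbb R\to\mathbb C$ with $$\Psi\Big(\sum_{j=1}^d\tilde x_j\hat\gamma_j\Big)=\prod_{j=1}^d\psi_j(\tilde x_j)\qquad\text{for all }\tilde x_1,\dots,\tilde x_d\in\mathbb R.$$ **Theorem.** Every bounded separable solution $\Psi$ of $(*)$ is a Bloch solution of $(*)$ with real quasimomentum or a finite linear combination, with complex coefficients, of Bloch solutions of $(*)$ (for the same $V$, $\lambda$ and $N$) with real quasimomenta $\mathbf k\in\mathbb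 R^d$. Moreover, if $\Psi\not\equiv 0$ is itself a Bloch solution with quasimomentum $\mathbf k\in\mathbb C^d$, then $\mathbf k\in\mathbb R^d$. -/

import Mathlib

open MeasureTheory Topology

/-- The class `C_p^l(ℝ)` of complex-valued functions on the line.

`C_p^0`: finitely many discontinuities on every bounded interval, and integrable there.
`C_p^(l+1)`: continuous functions that are differentiable, except possibly at finitely many points
of every bounded interval, with derivative in `C_p^l`. (If that derivative is required to be
continuous, as it is for `2 ≤ l + 1`, the function is in fact differentiable everywhere.) -/
def MemCp : ℕ → (ℝ → ℂ) → Prop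
  | 0, f => (∀ a b : ℝ, ({t | ¬ ContinuousAt f t} ∩ Set.Icc a b).Finite) ∧
      LocallyIntegrable f volume
  | l + 1, f => Continuous f ∧
      (∀ a b : ℝ, ({t | ¬ DifferentiableAt ℝ f t} ∩ Set.Icc a b).Finite) ∧
      MemCp l (deriv f)

/-- The unit vector in the direction of the `j`-th primitive vector. -/
noncomputable def primitiveDirection {d : ℕ} (γ : Fin d → EuclideanSpace ℝ (Fin d)) (j : Fin d) :
    EuclideanSpace ℝ (Fin d) :=
  ‖γ j‖⁻¹ • γ j

/-- The Bravais lattice `γ₁ℤ ⊕ ⋯ ⊕ γ_dℤ`. -/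
def bravaisLattice {d : ℕ} (γ : Fin d → EuclideanSpace ℝ (Fin d)) :
    Submodule ℤ (EuclideanSpace ℝ (Fin d)) :=
  Submodule.span ℤ (Set.range γ)

/-- Periodicity of a function with respect to the Bravais lattice. -/
def IsLatticePeriodic {d : ℕ} {β : Type*} (γ : Fin d → EuclideanSpace ℝ (Fin d))
    (f : EuclideanSpace ℝ (Fin d) → β) : Prop :=
  ∀ a ∈ bravaisLattice γ, ∀ r, f (r + a) = f r

/-- The class `⨂_j C_p^l(ℝ)`: the restriction of `f` to every line in the direction of a primitive
vector, parametrized by arc length, is in `C_p^l(ℝ)`. -/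
def MemTensorCp {d : ℕ} (γ : Fin d → EuclideanSpace ℝ (Fin d)) (l : ℕ)
    (f : EuclideanSpace ℝ (Fin d) → ℂ) : Prop :=
  ∀ (j : Fin d) (r : EuclideanSpace ℝ (Fin d)),
    MemCp l (fun t : ℝ => f (r + t • primitiveDirection γ j))

/-- `Ψ` is a product of functions of one variable in the oblique coordinates `x` along the
primitive directions, `r = ∑ j, x j • γ j / ‖γ j‖`. -/
def IsSeparableAlong {d : ℕ} (γ : Fin d → EuclideanSpace ℝ (Fin d))
    (Ψ : EuclideanSpace ℝ (Fin d) → ℂ) : Prop :=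
  ∃ ψ : Fin d → ℝ → ℂ, ∀ x : Fin d → ℝ,
    Ψ (∑ j, x j • primitiveDirection γ j) = ∏ j, ψ j (x j)

/-- `Ψ` is twice differentiable at `r`. -/
def TwiceDifferentiableAt {d : ℕ} (Ψ : EuclideanSpace ℝ (Fin d) → ℂ)
    (r : EuclideanSpace ℝ (Fin d)) : Prop :=
  (∀ᶠ y in 𝓝 r, DifferentiableAt ℝ Ψ y) ∧ DifferentiableAt ℝ (fderiv ℝ Ψ) r

/-- Solutions in `⨂_j C_p^2(ℝ)` of `-½ΔΨ + VΨ = λΨ`, the equation being satisfied pointwise, with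
classical derivatives, at every point outside the exceptional set `N`. -/
def IsSchrodingerSolution {d : ℕ} (γ : Fin d → EuclideanSpace ℝ (Fin d))
    (N : Set (EuclideanSpace ℝ (Fin d))) (V : EuclideanSpace ℝ (Fin d) → ℂ) (lam : ℂ)
    (Ψ : EuclideanSpace ℝ (Fin d) → ℂ) : Prop :=
  MemTensorCp γ 2 Ψ ∧
    ∀ r, r ∉ N → TwiceDifferentiableAt Ψ r ∧
      -(1 / 2 : ℂ) * Laplacian.laplacian Ψ r + V r * Ψ r = lam * Ψ r

/-- Bloch solutions with quasimomentum `k ∈ ℂ^d`: solutions of the form `e^{i k·r} p(r)` with a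
lattice-periodic function `p`. -/
def IsBlochSolution {d : ℕ} (γ : Fin d → EuclideanSpace ℝ (Fin d))
    (N : Set (EuclideanSpace ℝ (Fin d))) (V : EuclideanSpace ℝ (Fin d) → ℂ) (lam : ℂ)
    (k : Fin d → ℂ) (Φ : EuclideanSpace ℝ (Fin d) → ℂ) : Prop :=
  IsSchrodingerSolution γ N V lam Φ ∧
    ∃ p : EuclideanSpace ℝ (Fin d) → ℂ, IsLatticePeriodic γ p ∧
      ∀ r, Φ r = Complex.exp (Complex.I * ∑ i, k i * (r i : ℂ)) * p r

/-! Suppose Ψ ≠ 0. On a line in direction `γ k` through a point where Ψ does not vanish, all factors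
but `ψ k` are constant, so (*) becomes a second-order linear ODE for `ψ k`. Oblique coordinates only
add a first-order term with constant coefficient, and the potential has period `‖γ k‖`. The
translates of `ψ k` by multiples of `‖γ k‖` therefore stay in a solution space of dimension at most
two (`exists_finiteDimensional_translates`). A null set N is harmless: by Fubini almost every
parallel line meets it in a null set, and the ODE is needed only almost everywhere.

Expanding products, the lattice translates of Ψ span a finite-dimensional space S
(`finiteDimensional_span_lattice_translates`). It consists of bounded solutions and is invariant
under the commuting translations by the `γ j`. Over ℂ, S is the sum of their joint generalized
eigenspaces. A Jordan block would force linear growth, so boundedness leaves only genuine joint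
eigenvectors, with multipliers of modulus one (`le_span_quasiperiodic`). These are the Bloch
solutions with real quasimomentum. The same modulus argument shows that the quasimomentum of a
bounded nonzero Bloch function is real. -/

/-! ### Locally finite sets and the classes `MemCp` -/

/-- A subset of the line with finite intersection with every bounded interval. -/
def IsLocallyFiniteSet (D : Set ℝ) : Prop := ∀ a b : ℝ, (D ∩ Set.Icc a b).Finite

theorem IsLocallyFiniteSet.mono {D D' : Set ℝ} (h : IsLocallyFiniteSet D) (hD : D' ⊆ D) :
    IsLocallyFiniteSet D' :=
  fun a b => (h a b).subset (Set.inter_subset_inter_left _ hD)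

theorem IsLocallyFiniteSet.union {D D' : Set ℝ} (h : IsLocallyFiniteSet D)
    (h' : IsLocallyFiniteSet D') : IsLocallyFiniteSet (D ∪ D') := by
  intro a b
  rw [Set.union_inter_distrib_right]
  exact (h a b).union (h' a b)

theorem IsLocallyFiniteSet.countable {D : Set ℝ} (h : IsLocallyFiniteSet D) : D.Countable := by
  have : D ⊆ ⋃ n : ℕ, D ∩ Set.Icc (-(n : ℝ)) n := by
    intro t ht
    obtain ⟨n, hn⟩ := exists_nat_ge |t|
    exact Set.mem_iUnion.2 ⟨n, ht, abs_le.1 hn⟩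
  exact (Set.countable_iUnion fun n => (h _ _).countable).mono this

theorem IsLocallyFiniteSet.eventually_notMem {D : Set ℝ} (h : IsLocallyFiniteSet D) {t : ℝ}
    (ht : t ∉ D) : ∀ᶠ s in 𝓝 t, s ∉ D := by
  have h1 : ∀ᶠ s in 𝓝 t, s ∉ D ∩ Set.Icc (t - 1) (t + 1) :=
    (h _ _).isClosed.isOpen_compl.mem_nhds fun h' => ht h'.1
  have h2 : ∀ᶠ s in 𝓝 t, s ∈ Set.Icc (t - 1) (t + 1) :=
    Icc_mem_nhds (by linarith) (by linarith)
  filter_upwards [h1, h2] with s hs hs' hD using hs ⟨hD, hs'⟩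

theorem IsLocallyFiniteSet.ae_notMem {D : Set ℝ} (h : IsLocallyFiniteSet D) :
    ∀ᵐ t : ℝ, t ∉ D :=
  measure_eq_zero_iff_ae_notMem.1 (h.countable.measure_zero _)

/-- A locally finite set is closed and null, so changing values there affects neither continuity
elsewhere nor integrability. This absorbs the default values of `deriv` at exceptional points. -/
theorem MemCp.congr_zero {f g : ℝ → ℂ} (hf : MemCp 0 f) {D : Set ℝ} (hD : IsLocallyFiniteSet D)
    (hfg : ∀ t, t ∉ D → f t = g t) : MemCp 0 g := by
  refine ⟨?_, ?_⟩
  · refine (IsLocallyFiniteSet.union hf.1 hD).mono ?_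
    intro t ht
    by_contra hc
    simp only [Set.mem_union, Set.mem_ofPred_eq, not_or, not_not] at hc
    refine ht (hc.1.congr ?_)
    filter_upwards [hD.eventually_notMem hc.2] with s hs using hfg s hs
  · exact hf.2.congr (by filter_upwards [hD.ae_notMem] with t ht using hfg t ht)

theorem MemCp.add_zero {f g : ℝ → ℂ} (hf : MemCp 0 f) (hg : MemCp 0 g) :
    MemCp 0 (fun t => f t + g t) := by
  refine ⟨(IsLocallyFiniteSet.union hf.1 hg.1).mono ?_, hf.2.add hg.2⟩
  intro t ht
  by_contra hc
  simp only [Set.mem_union, Set.mem_ofPred_eq, not_or, not_not] at hc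
  exact ht (hc.1.add hc.2)

theorem MemCp.add_one {f g : ℝ → ℂ} (hf : MemCp 1 f) (hg : MemCp 1 g) :
    MemCp 1 (fun t => f t + g t) := by
  have hD := IsLocallyFiniteSet.union hf.2.1 hg.2.1
  have key : ∀ t, t ∉ {t | ¬ DifferentiableAt ℝ f t} ∪ {t | ¬ DifferentiableAt ℝ g t} →
      DifferentiableAt ℝ f t ∧ DifferentiableAt ℝ g t := by
    intro t ht
    simpa only [Set.mem_union, Set.mem_ofPred_eq, not_or, not_not] using ht
  refine ⟨hf.1.add hg.1, hD.mono ?_, (hf.2.2.add_zero hg.2.2).congr_zero hD ?_⟩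
  · intro t ht
    by_contra hc
    exact ht ((key t hc).1.add (key t hc).2)
  · intro t ht
    exact (deriv_fun_add (key t ht).1 (key t ht).2).symm

theorem MemCp.intervalIntegrable_zero {f : ℝ → ℂ} (hf : MemCp 0 f) (a b : ℝ) :
    IntervalIntegrable f volume a b :=
  (hf.2.integrableOn_isCompact isCompact_uIcc).intervalIntegrable

theorem MemCp.integral_deriv {f : ℝ → ℂ} (hf : MemCp 1 f) (a b : ℝ) :
    ∫ t in a..b, deriv f t = f b - f a := by
  refine integral_eq_of_hasDerivAt_off_countable f (deriv f)
    (IsLocallyFiniteSet.countable hf.2.1) hf.1.continuousOn ?_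
    (hf.2.2.intervalIntegrable_zero a b)
  intro x hx
  exact (not_not.1 hx.2 : DifferentiableAt ℝ f x).hasDerivAt

theorem MemCp.zero_of_one {f : ℝ → ℂ} (hf : MemCp 1 f) : MemCp 0 f :=
  ⟨fun a b => by simp [hf.1.continuousAt], hf.1.locallyIntegrable⟩

/-- The derivative is continuous and f is its primitive, so the exceptional points disappear by the
fundamental theorem of calculus. -/
theorem MemCp.differentiable {f : ℝ → ℂ} (hf : MemCp 2 f) : Differentiable ℝ f := by
  have hcont : Continuous (deriv f) := hf.2.2.1
  have hf1 : MemCp 1 f := ⟨hf.1, hf.2.1, hf.2.2.zero_of_one⟩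
  have h : ∀ t, f t = f 0 + ∫ s in (0 : ℝ)..t, deriv f s := by
    intro t
    rw [hf1.integral_deriv]
    ring
  intro t
  have := (intervalIntegral.integral_hasDerivAt_right (hcont.intervalIntegrable 0 t)
    hcont.stronglyMeasurable.stronglyMeasurableAtFilter hcont.continuousAt).const_add (f 0)
  rw [funext h]
  exact this.differentiableAt

theorem MemCp.add_two {f g : ℝ → ℂ} (hf : MemCp 2 f) (hg : MemCp 2 g) :
    MemCp 2 (fun t => f t + g t) := by
  have h1 := hf.differentiable
  have h2 := hg.differentiable
  refine ⟨hf.1.add hg.1, fun a b => ?_, ?_⟩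
  · have : ∀ t, DifferentiableAt ℝ (fun t => f t + g t) t := fun t => (h1 t).add (h2 t)
    simp [this]
  · have : deriv (fun t => f t + g t) = fun t => deriv f t + deriv g t :=
      funext fun t => deriv_fun_add (h1 t) (h2 t)
    rw [this]
    exact hf.2.2.add_one hg.2.2

theorem MemCp.const_mul {l : ℕ} (c : ℂ) : ∀ {f : ℝ → ℂ}, MemCp l f →
    MemCp l (fun t => c * f t) := by
  induction l with
  | zero =>
    intro f hf
    refine ⟨IsLocallyFiniteSet.mono hf.1 fun t ht h => ht (continuousAt_const.mul h), ?_⟩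
    exact hf.2.smul c
  | succ l ih =>
    intro f hf
    refine ⟨continuous_const.mul hf.1,
      IsLocallyFiniteSet.mono hf.2.1 fun t ht h => ht (h.const_mul c), ?_⟩
    have : deriv (fun t => c * f t) = fun t => c * deriv f t :=
      funext fun t => deriv_const_mul_field c
    rw [this]
    exact ih hf.2.2

theorem MemCp.const_mul_iff {l : ℕ} {c : ℂ} (hc : c ≠ 0) {f : ℝ → ℂ} :
    MemCp l (fun t => c * f t) ↔ MemCp l f := by
  refine ⟨fun h => ?_, fun h => h.const_mul c⟩
  simpa [← mul_assoc, hc] using h.const_mul c⁻¹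

/-! ### Pointwise calculus of the Laplacian -/

section TwiceDifferentiable

variable {d : ℕ} {f g : EuclideanSpace ℝ (Fin d) → ℂ} {r : EuclideanSpace ℝ (Fin d)}

theorem laplacian_eq_sum_fderiv (f : EuclideanSpace ℝ (Fin d) → ℂ)
    (r : EuclideanSpace ℝ (Fin d)) :
    Laplacian.laplacian f r = ∑ m, fderiv ℝ (fderiv ℝ f) r
      (EuclideanSpace.basisFun (Fin d) ℝ m) (EuclideanSpace.basisFun (Fin d) ℝ m) := by
  rw [InnerProductSpace.laplacian_eq_iteratedFDeriv_orthonormalBasis f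
    (EuclideanSpace.basisFun (Fin d) ℝ)]
  simp [iteratedFDeriv_two_apply]

theorem TwiceDifferentiableAt.fderiv_add (hf : TwiceDifferentiableAt f r)
    (hg : TwiceDifferentiableAt g r) :
    fderiv ℝ (fun y => f y + g y) =ᶠ[𝓝 r] fun y => fderiv ℝ f y + fderiv ℝ g y := by
  filter_upwards [hf.1, hg.1] with y h1 h2 using fderiv_fun_add h1 h2

theorem TwiceDifferentiableAt.add (hf : TwiceDifferentiableAt f r)
    (hg : TwiceDifferentiableAt g r) : TwiceDifferentiableAt (fun y => f y + g y) r := by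
  refine ⟨?_, (hf.2.add hg.2).congr_of_eventuallyEq (hf.fderiv_add hg)⟩
  filter_upwards [hf.1, hg.1] with y h1 h2 using h1.add h2

theorem TwiceDifferentiableAt.laplacian_add (hf : TwiceDifferentiableAt f r)
    (hg : TwiceDifferentiableAt g r) : Laplacian.laplacian (fun y => f y + g y) r =
      Laplacian.laplacian f r + Laplacian.laplacian g r := by
  simp only [laplacian_eq_sum_fderiv, ← Finset.sum_add_distrib]
  rw [(hf.fderiv_add hg).fderiv_eq, fderiv_fun_add hf.2 hg.2]
  simp

theorem fderiv_const_mul_complex (c : ℂ) (f : EuclideanSpace ℝ (Fin d) → ℂ) :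
    fderiv ℝ (fun y => c * f y) = fun y => c • fderiv ℝ f y := by
  funext y
  exact congrFun (fderiv_const_smul_field (𝕜 := ℝ) (f := f) c) y

theorem TwiceDifferentiableAt.const_mul (c : ℂ) (hf : TwiceDifferentiableAt f r) :
    TwiceDifferentiableAt (fun y => c * f y) r := by
  refine ⟨?_, ?_⟩
  · filter_upwards [hf.1] with y h1 using h1.const_mul c
  · rw [fderiv_const_mul_complex]
    exact hf.2.const_smul c

theorem TwiceDifferentiableAt.laplacian_const_mul (c : ℂ) (hf : TwiceDifferentiableAt f r) :
    Laplacian.laplacian (fun y => c * f y) r = c * Laplacian.laplacian f r := by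
  simp only [laplacian_eq_sum_fderiv, Finset.mul_sum]
  rw [fderiv_const_mul_complex, fderiv_fun_const_smul hf.2]
  simp

theorem fderiv_translate (a : EuclideanSpace ℝ (Fin d)) {F : Type*} [NormedAddCommGroup F]
    [NormedSpace ℝ F] (f : EuclideanSpace ℝ (Fin d) → F) :
    fderiv ℝ (fun y => f (y + a)) = fun y => fderiv ℝ f (y + a) :=
  funext fun _ => fderiv_comp_add_right a

theorem TwiceDifferentiableAt.translate {a : EuclideanSpace ℝ (Fin d)}
    (hf : TwiceDifferentiableAt f (r + a)) : TwiceDifferentiableAt (fun y => f (y + a)) r := by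
  refine ⟨?_, ?_⟩
  · have : Filter.Tendsto (fun y => y + a) (𝓝 r) (𝓝 (r + a)) :=
      (continuous_add_const a).tendsto r
    filter_upwards [this.eventually hf.1] with y h1 using (differentiableAt_comp_add_right a).2 h1
  · rw [fderiv_translate]
    exact (differentiableAt_comp_add_right a).2 hf.2

theorem laplacian_translate (a : EuclideanSpace ℝ (Fin d)) :
    Laplacian.laplacian (fun y => f (y + a)) r = Laplacian.laplacian f (r + a) := by
  simp only [laplacian_eq_sum_fderiv, fderiv_translate]

end TwiceDifferentiable

/-! ### Linearity and lattice invariance of the Schrödinger equation -/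

section Solutions

variable {d : ℕ} {γ : Fin d → EuclideanSpace ℝ (Fin d)} {N : Set (EuclideanSpace ℝ (Fin d))}
  {V : EuclideanSpace ℝ (Fin d) → ℂ} {lam : ℂ} {f g : EuclideanSpace ℝ (Fin d) → ℂ}

theorem IsSchrodingerSolution.add (hf : IsSchrodingerSolution γ N V lam f)
    (hg : IsSchrodingerSolution γ N V lam g) :
    IsSchrodingerSolution γ N V lam (fun r => f r + g r) := by
  refine ⟨fun j r => (hf.1 j r).add_two (hg.1 j r), fun r hr => ?_⟩
  obtain ⟨h1, h2⟩ := hf.2 r hr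
  obtain ⟨h3, h4⟩ := hg.2 r hr
  refine ⟨h1.add h3, ?_⟩
  rw [h1.laplacian_add h3]
  linear_combination h2 + h4

theorem IsSchrodingerSolution.const_mul (c : ℂ) (hf : IsSchrodingerSolution γ N V lam f) :
    IsSchrodingerSolution γ N V lam (fun r => c * f r) := by
  refine ⟨fun j r => (hf.1 j r).const_mul c, fun r hr => ?_⟩
  obtain ⟨h1, h2⟩ := hf.2 r hr
  refine ⟨h1.const_mul c, ?_⟩
  rw [h1.laplacian_const_mul c]
  linear_combination c * h2

theorem IsSchrodingerSolution.translate (hf : IsSchrodingerSolution γ N V lam f)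
    (hNper : IsLatticePeriodic γ (fun r => r ∈ N)) (hVper : IsLatticePeriodic γ V)
    {a : EuclideanSpace ℝ (Fin d)} (ha : a ∈ bravaisLattice γ) :
    IsSchrodingerSolution γ N V lam (fun r => f (r + a)) := by
  refine ⟨fun j r => ?_, fun r hr => ?_⟩
  · simpa only [add_right_comm] using hf.1 j (r + a)
  · obtain ⟨h1, h2⟩ := hf.2 (r + a) fun h => hr ((hNper a ha r).mp h)
    refine ⟨h1.translate, ?_⟩
    rw [laplacian_translate, ← hVper a ha r]
    exact h2

theorem isSchrodingerSolution_of_mem_span {S : Set (EuclideanSpace ℝ (Fin d) → ℂ)}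
    (hS : S.Nonempty) (h : ∀ f ∈ S, IsSchrodingerSolution γ N V lam f)
    (hf : f ∈ Submodule.span ℂ S) : IsSchrodingerSolution γ N V lam f := by
  induction hf using Submodule.span_induction with
  | mem f hf => exact h f hf
  | zero =>
    obtain ⟨g, hg⟩ := hS
    have := (h g hg).const_mul 0
    simp only [zero_mul] at this
    exact this
  | add f g _ _ hf hg => exact hf.add hg
  | smul c f _ hf => exact hf.const_mul c

end Solutions

/-! ### Second-order linear ODEs with locally integrable coefficients -/

/-- Solutions of `h'' = p h' + q h` with locally integrable `q`, the equation being integrated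
once. -/
noncomputable def integratedSolutions (p : ℂ) (q : ℝ → ℂ) (hq : LocallyIntegrable q volume) :
    Submodule ℂ (ℝ → ℂ) where
  carrier := {h | Differentiable ℝ h ∧ Continuous (deriv h) ∧
    ∀ s t, deriv h t - deriv h s = ∫ u in s..t, (p * deriv h u + q u * h u)}
  zero_mem' := by
    have : deriv (0 : ℝ → ℂ) = 0 := by ext; simp [Pi.zero_def]
    refine ⟨differentiable_const 0, ?_, fun s t => ?_⟩
    · rw [this]; exact continuous_const
    · simp [this]
  add_mem' := by
    rintro f g ⟨hf, hf', hfe⟩ ⟨hg, hg', hge⟩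
    have hd : deriv (f + g) = fun t => deriv f t + deriv g t :=
      funext fun t => deriv_add (hf t) (hg t)
    refine ⟨hf.add hg, by rw [hd]; exact hf'.add hg', fun s t => ?_⟩
    have hint : ∀ h : ℝ → ℂ, Differentiable ℝ h → Continuous (deriv h) →
        IntervalIntegrable (fun u => p * deriv h u + q u * h u) volume s t := by
      intro h h1 h2
      refine ((continuous_const.mul h2).intervalIntegrable s t).add ?_
      exact IntervalIntegrable.mul_continuousOn
        (hq.integrableOn_isCompact isCompact_uIcc).intervalIntegrable h1.continuous.continuousOn
    calc deriv (f + g) t - deriv (f + g) s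
        = (deriv f t - deriv f s) + (deriv g t - deriv g s) := by rw [hd]; ring
      _ = _ := by
        rw [hfe, hge, ← intervalIntegral.integral_add (hint f hf hf') (hint g hg hg')]
        refine intervalIntegral.integral_congr fun u _ => ?_
        simp only [hd, Pi.add_apply]
        ring
  smul_mem' := by
    rintro c f ⟨hf, hf', hfe⟩
    have hd : deriv (c • f) = fun t => c * deriv f t :=
      funext fun t => deriv_const_mul_field c
    refine ⟨hf.const_smul c, by rw [hd]; exact continuous_const.mul hf', fun s t => ?_⟩
    calc deriv (c • f) t - deriv (c • f) s = c * (deriv f t - deriv f s) := by rw [hd]; ring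
      _ = _ := by
        rw [hfe, ← intervalIntegral.integral_const_mul]
        refine intervalIntegral.integral_congr fun u _ => ?_
        simp only [hd, Pi.smul_apply, smul_eq_mul]
        ring

section Uniqueness

variable {p : ℂ} {q : ℝ → ℂ} {hq : LocallyIntegrable q volume} {h : ℝ → ℂ}

/-- The Picard estimate: with zero data at `t₀`, both h and h' are integrals from `t₀`, with
integrands at most `M` and `(‖p‖ + ‖q‖) M`. Absolute values around the integral allow t on either
side of `t₀`. -/
theorem norm_state_le_integral (hh : h ∈ integratedSolutions p q hq) {t₀ : ℝ} (h0 : h t₀ = 0)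
    (h0' : deriv h t₀ = 0) {M : ℝ} {t : ℝ}
    (hM : ∀ u ∈ Set.uIcc t₀ t, ‖h u‖ + ‖deriv h u‖ ≤ M) :
    ‖h t‖ + ‖deriv h t‖ ≤ |∫ u in t₀..t, (1 + ‖p‖ + ‖q u‖)| * M := by
  obtain ⟨hd, hc, he⟩ := hh
  have hqi : IntervalIntegrable q volume t₀ t :=
    (hq.integrableOn_isCompact isCompact_uIcc).intervalIntegrable
  have e1 : h t = ∫ u in t₀..t, deriv h u := by
    rw [intervalIntegral.integral_deriv_eq_sub (fun x _ => hd x) (hc.intervalIntegrable _ _), h0,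
      sub_zero]
  have e2 : deriv h t = ∫ u in t₀..t, (p * deriv h u + q u * h u) := by
    rw [← he, h0', sub_zero]
  have b1 : ‖h t‖ ≤ |∫ u in t₀..t, M| := by
    rw [e1]
    refine intervalIntegral.norm_integral_le_abs_of_norm_le ?_ (by simp)
    refine (ae_restrict_mem measurableSet_uIoc).mono fun u hu => ?_
    linarith [hM u (Set.uIoc_subset_uIcc hu), norm_nonneg (h u)]
  have i2 : IntervalIntegrable (fun u => (‖p‖ + ‖q u‖) * M) volume t₀ t :=
    ((intervalIntegrable_const).add hqi.norm).mul_const M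
  have b2 : ‖deriv h t‖ ≤ |∫ u in t₀..t, (‖p‖ + ‖q u‖) * M| := by
    rw [e2]
    refine intervalIntegral.norm_integral_le_abs_of_norm_le ?_ i2
    refine (ae_restrict_mem measurableSet_uIoc).mono fun u hu => ?_
    have hu' := hM u (Set.uIoc_subset_uIcc hu)
    have n1 := norm_nonneg (h u)
    have n2 := norm_nonneg (deriv h u)
    calc ‖p * deriv h u + q u * h u‖ ≤ ‖p‖ * ‖deriv h u‖ + ‖q u‖ * ‖h u‖ := by
          rw [← norm_mul, ← norm_mul]; exact norm_add_le _ _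
      _ ≤ ‖p‖ * M + ‖q u‖ * M := by gcongr <;> linarith
      _ = _ := by ring
  have hM0 : 0 ≤ M := by
    have := hM t Set.right_mem_uIcc
    linarith [norm_nonneg (h t), norm_nonneg (deriv h t)]
  have split : ∫ u in t₀..t, (1 + ‖p‖ + ‖q u‖) =
      (∫ u in t₀..t, (1 : ℝ)) + ∫ u in t₀..t, (‖p‖ + ‖q u‖) := by
    rw [← intervalIntegral.integral_add intervalIntegrable_const
      (intervalIntegrable_const.add hqi.norm)]
    simp only [add_assoc]
  -- Both integrals carry the sign of `t - t₀`, so their absolute values add.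
  have sign : |∫ u in t₀..t, (1 + ‖p‖ + ‖q u‖)| =
      |∫ u in t₀..t, (1 : ℝ)| + |∫ u in t₀..t, (‖p‖ + ‖q u‖)| := by
    rw [split]
    rcases le_total t₀ t with hle | hle
    · rw [abs_add_eq_add_abs_iff]
      exact Or.inl ⟨intervalIntegral.integral_nonneg hle fun _ _ => zero_le_one,
        intervalIntegral.integral_nonneg hle fun _ _ => by positivity⟩
    · rw [abs_add_eq_add_abs_iff]
      refine Or.inr ⟨?_, ?_⟩ <;> rw [intervalIntegral.integral_symm, neg_nonpos]
      · exact intervalIntegral.integral_nonneg hle fun _ _ => zero_le_one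
      · exact intervalIntegral.integral_nonneg hle fun _ _ => by positivity
  have m1 : |∫ u in t₀..t, M| = |∫ u in t₀..t, (1 : ℝ)| * M := by
    simp [abs_mul, abs_of_nonneg hM0]
  rw [intervalIntegral.integral_mul_const, abs_mul, abs_of_nonneg hM0] at b2
  rw [sign, add_mul, ← m1]
  exact add_le_add b1 b2

/-- Near `t₀` the factor in the Picard estimate is below 1/2. Applied at a maximum point of `‖h‖ +
‖h'‖`, the estimate bounds the maximum by half of itself, so it vanishes. -/
theorem eventually_state_eq_zero (hh : h ∈ integratedSolutions p q hq) {t₀ : ℝ} (h0 : h t₀ = 0)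
    (h0' : deriv h t₀ = 0) : ∀ᶠ t in 𝓝 t₀, h t = 0 ∧ deriv h t = 0 := by
  have hcont : Continuous fun t => ∫ u in t₀..t, (1 + ‖p‖ + ‖q u‖) := by
    refine intervalIntegral.continuous_primitive (fun a b => ?_) t₀
    exact intervalIntegrable_const.add
      (hq.integrableOn_isCompact isCompact_uIcc).intervalIntegrable.norm
  have hsmall : ∀ᶠ t in 𝓝 t₀, |∫ u in t₀..t, (1 + ‖p‖ + ‖q u‖)| < 1 / 2 := by
    refine (hcont.abs.tendsto t₀).eventually_lt_const ?_
    simp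
  obtain ⟨ε, hε, hball⟩ := Metric.nhds_basis_closedBall.eventually_iff.1 hsmall
  have hsc : Continuous fun u => ‖h u‖ + ‖deriv h u‖ := hh.1.continuous.norm.add hh.2.1.norm
  obtain ⟨t₁, ht₁, hmax⟩ := (isCompact_closedBall t₀ ε).exists_isMaxOn
    ⟨t₀, Metric.mem_closedBall_self hε.le⟩ hsc.continuousOn
  have hsub : Set.uIcc t₀ t₁ ⊆ Metric.closedBall t₀ ε := by
    rw [← segment_eq_uIcc]
    exact (convex_closedBall t₀ ε).segment_subset (Metric.mem_closedBall_self hε.le) ht₁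
  have key := norm_state_le_integral hh h0 h0' (t := t₁) fun u hu => hmax (hsub hu)
  have hlt := hball ht₁
  have hz : ‖h t₁‖ + ‖deriv h t₁‖ ≤ 0 := by
    have n1 := norm_nonneg (h t₁)
    have n2 := norm_nonneg (deriv h t₁)
    nlinarith
  filter_upwards [Metric.closedBall_mem_nhds t₀ hε] with t ht
  have hle : ‖h t‖ + ‖deriv h t‖ ≤ 0 := (hmax ht).trans hz
  have n1 := norm_nonneg (h t)
  have n2 := norm_nonneg (deriv h t)
  exact ⟨norm_eq_zero.1 (by linarith), norm_eq_zero.1 (by linarith)⟩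

theorem eq_zero_of_state_eq_zero (hh : h ∈ integratedSolutions p q hq) (h0 : h 0 = 0)
    (h0' : deriv h 0 = 0) : h = 0 := by
  have hclopen : IsClopen {t | h t = 0 ∧ deriv h t = 0} := by
    refine ⟨(isClosed_eq hh.1.continuous continuous_const).inter
      (isClosed_eq hh.2.1 continuous_const), ?_⟩
    exact isOpen_iff_mem_nhds.2 fun t ht => eventually_state_eq_zero hh ht.1 ht.2
  have huniv := hclopen.eq_univ ⟨0, h0, h0'⟩
  funext t
  have : t ∈ {t | h t = 0 ∧ deriv h t = 0} := by rw [huniv]; trivial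
  exact this.1

/-- By uniqueness, the initial data at 0 embed the solution space in ℂ². -/
theorem finiteDimensional_integratedSolutions :
    FiniteDimensional ℂ (integratedSolutions p q hq) := by
  let ev : integratedSolutions p q hq →ₗ[ℂ] ℂ × ℂ :=
    { toFun := fun h => ((h : ℝ → ℂ) 0, deriv (h : ℝ → ℂ) 0)
      map_add' := fun f g => by
        simp [deriv_add (f.2.1 0) (g.2.1 0)]
      map_smul' := fun c f => by
        simp [deriv_const_smul_field] }
  refine FiniteDimensional.of_injective ev ?_
  rw [← LinearMap.ker_eq_bot, LinearMap.ker_eq_bot']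
  intro h hh
  have := Prod.ext_iff.1 hh
  exact Subtype.ext (eq_zero_of_state_eq_zero h.2 this.1 this.2)

theorem translate_mem_integratedSolutions (hh : h ∈ integratedSolutions p q hq) {s : ℝ}
    (hs : ∀ t, q (t + s) = q t) : (fun t => h (t + s)) ∈ integratedSolutions p q hq := by
  obtain ⟨hd, hc, he⟩ := hh
  have hder : deriv (fun t => h (t + s)) = fun t => deriv h (t + s) :=
    funext fun t => deriv_comp_add_const h s t
  refine ⟨hd.comp (differentiable_id.add_const s), ?_, fun a b => ?_⟩
  · rw [hder]; exact hc.comp (continuous_add_const s)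
  · simp only [hder]
    rw [he, ← intervalIntegral.integral_comp_add_right]
    simp only [hs]

end Uniqueness

theorem MemCp.mem_integratedSolutions {h : ℝ → ℂ} (hh : MemCp 2 h) {p : ℂ} {q : ℝ → ℂ}
    (hq : LocallyIntegrable q volume)
    (hode : ∀ᵐ t : ℝ, deriv (deriv h) t = p * deriv h t + q t * h t) :
    h ∈ integratedSolutions p q hq := by
  refine ⟨hh.differentiable, hh.2.2.1, fun s t => ?_⟩
  rw [← hh.2.2.integral_deriv s t]
  exact intervalIntegral.integral_congr_ae (hode.mono fun u hu _ => hu)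

/-! ### Null sets along parallel lines -/

/-- Fubini: for each fixed t the set of bad r is a translate of N, hence null. Passing to a
measurable null superset allows the exchange of quantifiers. -/
theorem ae_ae_line_notMem {d : ℕ} {N : Set (EuclideanSpace ℝ (Fin d))} (hN : volume N = 0)
    (v : EuclideanSpace ℝ (Fin d)) : ∀ᵐ r : EuclideanSpace ℝ (Fin d), ∀ᵐ t : ℝ, r + t • v ∉ N := by
  have hM : volume (toMeasurable volume N) = 0 := by rwa [measure_toMeasurable]
  have hmeas : MeasurableSet {x : EuclideanSpace ℝ (Fin d) × ℝ |
      x.1 + x.2 • v ∉ toMeasurable volume N} :=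
    (measurableSet_toMeasurable volume N).compl.preimage
      (by fun_prop : Measurable fun x : EuclideanSpace ℝ (Fin d) × ℝ => x.1 + x.2 • v)
  have h : ∀ᵐ r : EuclideanSpace ℝ (Fin d), ∀ᵐ t : ℝ, r + t • v ∉ toMeasurable volume N := by
    rw [Measure.ae_ae_comm hmeas]
    refine Filter.Eventually.of_forall fun t => ?_
    rw [ae_iff]
    simp only [not_not]
    exact (measure_preimage_add_right volume (t • v) (toMeasurable volume N)).trans hM
  filter_upwards [h] with r hr
  filter_upwards [hr] with t ht h' using ht (subset_toMeasurable volume N h')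

/-! ### The Laplacian of a product in oblique coordinates -/

section Coordinates

variable {d : ℕ}

theorem exists_primitiveBasis {γ : Fin d → EuclideanSpace ℝ (Fin d)}
    (hγ : LinearIndependent ℝ γ) :
    ∃ b : Module.Basis (Fin d) ℝ (EuclideanSpace ℝ (Fin d)), ∀ j, b j = primitiveDirection γ j := by
  have hli : LinearIndependent ℝ (primitiveDirection γ) :=
    hγ.units_smul fun j => Units.mk0 ‖γ j‖⁻¹ (inv_ne_zero (norm_ne_zero_iff.2 (hγ.ne_zero j)))
  rcases Nat.eq_zero_or_pos d with rfl | hd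
  · exact ⟨(EuclideanSpace.basisFun (Fin 0) ℝ).toBasis, fun j => j.elim0⟩
  · have : Nonempty (Fin d) := ⟨⟨0, hd⟩⟩
    exact ⟨basisOfLinearIndependentOfCardEqFinrank hli (by simp), fun j => by simp⟩

variable (b : Module.Basis (Fin d) ℝ (EuclideanSpace ℝ (Fin d)))

theorem repr_add_smul_self (r : EuclideanSpace ℝ (Fin d)) (t : ℝ) (i l : Fin d) :
    b.repr (r + t • b i) l = b.repr r l + if l = i then t else 0 := by
  simp [Finsupp.single_apply, eq_comm]

theorem deriv_prod_along (φ : Fin d → ℝ → ℂ) (r : EuclideanSpace ℝ (Fin d)) (i : Fin d) :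
    deriv (fun s : ℝ => ∏ l, φ l (b.repr (r + s • b i) l)) 0 =
      ∏ l, Function.update φ i (deriv (φ i)) l (b.repr r l) := by
  have h : (fun s : ℝ => ∏ l, φ l (b.repr (r + s • b i) l)) = fun s : ℝ =>
      φ i (b.repr r i + s) * ∏ l ∈ Finset.univ.erase i, φ l (b.repr r l) := by
    funext s
    rw [← Finset.mul_prod_erase _ _ (Finset.mem_univ i)]
    congr 1
    · rw [repr_add_smul_self, if_pos rfl]
    · refine Finset.prod_congr rfl fun l hl => ?_
      rw [repr_add_smul_self, if_neg (Finset.ne_of_mem_erase hl), add_zero]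
  rw [h, deriv_mul_const_field, deriv_comp_const_add, add_zero,
    ← Finset.mul_prod_erase _ _ (Finset.mem_univ i), Function.update_self]
  congr 1
  refine Finset.prod_congr rfl fun l hl => ?_
  rw [Function.update_of_ne (Finset.ne_of_mem_erase hl)]

theorem fderiv_eq_deriv_along {F : Type*} [NormedAddCommGroup F] [NormedSpace ℝ F]
    {f : EuclideanSpace ℝ (Fin d) → F} {r : EuclideanSpace ℝ (Fin d)}
    (hf : DifferentiableAt ℝ f r) (v : EuclideanSpace ℝ (Fin d)) :
    fderiv ℝ f r v = deriv (fun s : ℝ => f (r + s • v)) 0 :=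
  (hf.hasFDerivAt.hasLineDerivAt v).lineDeriv.symm

variable {b} {Ψ : EuclideanSpace ℝ (Fin d) → ℂ} {ψ : Fin d → ℝ → ℂ}

/-- The nested updates treat `i = j` and `i ≠ j` uniformly: factor j is differentiated first, then
factor i of the resulting family. No differentiability of the factors is needed, since pulling a
constant out of `deriv` is unconditional. -/
theorem TwiceDifferentiableAt.fderiv_fderiv_prod (hΨ : ∀ r, Ψ r = ∏ l, ψ l (b.repr r l))
    {r : EuclideanSpace ℝ (Fin d)} (h : TwiceDifferentiableAt Ψ r) (i j : Fin d) :
    fderiv ℝ (fderiv ℝ Ψ) r (b i) (b j) =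
      ∏ l, Function.update (Function.update ψ j (deriv (ψ j))) i
        (deriv (Function.update ψ j (deriv (ψ j)) i)) l (b.repr r l) := by
  have h1 : ∀ᶠ y in 𝓝 r, fderiv ℝ Ψ y (b j) =
      ∏ l, Function.update ψ j (deriv (ψ j)) l (b.repr y l) := by
    filter_upwards [h.1] with y hy
    rw [fderiv_eq_deriv_along hy, ← deriv_prod_along]
    simp only [hΨ]
  have h2 : fderiv ℝ (fderiv ℝ Ψ) r (b i) (b j) =
      fderiv ℝ (fun y => fderiv ℝ Ψ y (b j)) r (b i) := by
    rw [fderiv_clm_apply h.2 (differentiableAt_const _)]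
    simp
  rw [h2, fderiv_eq_deriv_along (h.2.clm_apply (differentiableAt_const _)), ← deriv_prod_along]
  refine Filter.EventuallyEq.deriv_eq ?_
  have hc : Filter.Tendsto (fun s : ℝ => r + s • b i) (𝓝 0) (𝓝 r) := by
    have : Continuous fun s : ℝ => r + s • b i := by fun_prop
    simpa using this.tendsto 0
  exact hc.eventually h1

theorem prod_eq_mul_prod_erase_along (φ : Fin d → ℝ → ℂ) (r : EuclideanSpace ℝ (Fin d))
    (k : Fin d) (t : ℝ) : ∏ l, φ l (b.repr (r + t • b k) l) =
      φ k (b.repr r k + t) * ∏ l ∈ Finset.univ.erase k, φ l (b.repr r l) := by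
  rw [← Finset.mul_prod_erase _ _ (Finset.mem_univ k)]
  congr 1
  · rw [repr_add_smul_self, if_pos rfl]
  · refine Finset.prod_congr rfl fun l hl => ?_
    rw [repr_add_smul_self, if_neg (Finset.ne_of_mem_erase hl), add_zero]

/-- Sort the second derivatives by how many of the indices i, j equal k: two give the second
derivative of `ψ k`, one gives the first, none gives `ψ k` itself. The remaining factors do not
change along the line. -/
theorem exists_laplacian_along (hΨ : ∀ r, Ψ r = ∏ l, ψ l (b.repr r l))
    (r : EuclideanSpace ℝ (Fin d)) (k : Fin d) :
    ∃ A : ℝ, A ≠ 0 ∧ ∃ B C : ℂ, ∀ t : ℝ, TwiceDifferentiableAt Ψ (r + t • b k) →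
      Laplacian.laplacian Ψ (r + t • b k) =
        A * (∏ l ∈ Finset.univ.erase k, ψ l (b.repr r l)) * deriv (deriv (ψ k)) (b.repr r k + t) +
        B * deriv (ψ k) (b.repr r k + t) + C * ψ k (b.repr r k + t) := by
  set R := ∏ l ∈ Finset.univ.erase k, ψ l (b.repr r l) with hR
  let e := EuclideanSpace.basisFun (Fin d) ℝ
  let D : Fin d → Fin d → ℂ := fun i j => ∏ l ∈ Finset.univ.erase k,
    Function.update (Function.update ψ j (deriv (ψ j))) i
        (deriv (Function.update ψ j (deriv (ψ j)) i)) l (b.repr r l)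
  -- This sum is the squared length of the coordinate functional of `b k`, which takes the value 1
  -- at `b k`.
  have hA : (∑ m, b.repr (e m) k * b.repr (e m) k) ≠ 0 := by
    intro h0
    rw [Finset.sum_eq_zero_iff_of_nonneg fun m _ => mul_self_nonneg _] at h0
    have hz : (b.coord k) = 0 := by
      refine e.toBasis.ext fun m => ?_
      simpa using h0 m (Finset.mem_univ m)
    have := congrArg (fun f => f (b k)) hz
    simp at this
  -- The inverse Gram matrix of `b`, which gives the coefficients of the Laplacian in oblique
  -- coordinates.
  let H : Fin d → Fin d → ℂ := fun i j => ∑ m, ((b.repr (e m) i * b.repr (e m) j : ℝ) : ℂ)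
  refine ⟨∑ m, b.repr (e m) k * b.repr (e m) k, hA,
    ∑ i, ∑ j, (if i = k ∧ j = k then 0 else if i = k ∨ j = k then H i j * D i j else 0),
    ∑ i, ∑ j, (if i = k ∨ j = k then 0 else H i j * D i j), fun t ht => ?_⟩
  have hlap : Laplacian.laplacian Ψ (r + t • b k) =
      ∑ i, ∑ j, H i j * fderiv ℝ (fderiv ℝ Ψ) (r + t • b k) (b i) (b j) := by
    rw [laplacian_eq_sum_fderiv]
    have : ∀ m, fderiv ℝ (fderiv ℝ Ψ) (r + t • b k) (e m) (e m) =
        ∑ i, ∑ j, ((b.repr (e m) i * b.repr (e m) j : ℝ) : ℂ) *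
          fderiv ℝ (fderiv ℝ Ψ) (r + t • b k) (b i) (b j) := by
      intro m
      conv_lhs => rw [← b.sum_repr (e m)]
      simp only [map_sum, map_smul, FunLike.coe_sum, Finset.sum_apply, FunLike.coe_smul,
        Pi.smul_apply, Complex.real_smul, Finset.mul_sum, Complex.ofReal_mul, mul_assoc]
      rw [Finset.sum_comm]
      simp only [mul_left_comm]
    change ∑ m, fderiv ℝ (fderiv ℝ Ψ) (r + t • b k) (e m) (e m) = _
    simp only [this, H, Finset.sum_mul]
    rw [Finset.sum_comm]
    exact Finset.sum_congr rfl fun i _ => Finset.sum_comm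
  have hterm : ∀ i j, H i j * fderiv ℝ (fderiv ℝ Ψ) (r + t • b k) (b i) (b j) =
      (if i = k then if j = k then H k k * R * deriv (deriv (ψ k)) (b.repr r k + t) else 0 else 0) +
      (if i = k ∧ j = k then 0 else if i = k ∨ j = k then H i j * D i j else 0) *
        deriv (ψ k) (b.repr r k + t) +
      (if i = k ∨ j = k then 0 else H i j * D i j) * ψ k (b.repr r k + t) := by
    intro i j
    rw [ht.fderiv_fderiv_prod hΨ, prod_eq_mul_prod_erase_along]
    change H i j * (_ * D i j) = _
    rcases eq_or_ne i k with rfl | hi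
    · rcases eq_or_ne j i with rfl | hj
      · have : D j j = R := by
          refine Finset.prod_congr rfl fun l hl => ?_
          have := Finset.ne_of_mem_erase hl
          simp [this]
        simp [this]
        ring
      · simp [hj, hj.symm]
        ring
    · rcases eq_or_ne j k with rfl | hj
      · simp [hi, hi.symm]
        ring
      · simp [hi, hi.symm, hj, hj.symm]
        ring
  rw [hlap]
  simp only [hterm, Finset.sum_add_distrib, ← Finset.sum_mul]
  simp [H]

end Coordinates

/-! ### From the separable solution to a finite-dimensional space of translates -/

theorem norm_smul_primitiveDirection_eq {d : ℕ} {γ : Fin d → EuclideanSpace ℝ (Fin d)}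
    (hγ : LinearIndependent ℝ γ) (k : Fin d) : ‖γ k‖ • primitiveDirection γ k = γ k := by
  rw [primitiveDirection, smul_smul, mul_inv_cancel₀ (norm_ne_zero_iff.2 (hγ.ne_zero k)), one_smul]

section Factors

variable {d : ℕ} {γ : Fin d → EuclideanSpace ℝ (Fin d)} {N : Set (EuclideanSpace ℝ (Fin d))}
  {V : EuclideanSpace ℝ (Fin d) → ℂ} {lam : ℂ}
  {b : Module.Basis (Fin d) ℝ (EuclideanSpace ℝ (Fin d))} {Ψ : EuclideanSpace ℝ (Fin d) → ℂ}
  {ψ : Fin d → ℝ → ℂ}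

theorem memCp_two_factor (hb : ∀ j, b j = primitiveDirection γ j)
    (hΨ : ∀ r, Ψ r = ∏ l, ψ l (b.repr r l)) (hreg : MemTensorCp γ 2 Ψ)
    {r : EuclideanSpace ℝ (Fin d)} (hr : Ψ r ≠ 0) (k : Fin d) :
    MemCp 2 (fun t => ψ k (b.repr r k + t)) := by
  have hR : ∏ l ∈ Finset.univ.erase k, ψ l (b.repr r l) ≠ 0 := by
    intro h
    apply hr
    rw [hΨ, ← Finset.mul_prod_erase _ _ (Finset.mem_univ k), h, mul_zero]
  have h := hreg k r
  simp only [← hb, hΨ, prod_eq_mul_prod_erase_along] at h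
  simp only [mul_comm (ψ k _)] at h
  exact (MemCp.const_mul_iff hR).1 h

/-- The tensor class gives regularity only along primitive lines. Joint continuity comes from the
factors, each continuous because the product of the others is nonzero at r. -/
theorem continuous_of_factors (hb : ∀ j, b j = primitiveDirection γ j)
    (hΨ : ∀ r, Ψ r = ∏ l, ψ l (b.repr r l)) (hreg : MemTensorCp γ 2 Ψ)
    {r : EuclideanSpace ℝ (Fin d)} (hr : Ψ r ≠ 0) : Continuous Ψ := by
  have hψ : ∀ k, Continuous (ψ k) := by
    intro k
    have := (memCp_two_factor hb hΨ hreg hr k).1.comp (continuous_sub_right (b.repr r k))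
    simpa [Function.comp_def] using! this
  rw [funext hΨ]
  refine continuous_finsetProd _ fun l _ => (hψ l).comp ?_
  exact (b.coord l).continuous_of_finiteDimensional

/-- The open set where Ψ ≠ 0 has positive measure, so it is not contained in the null set of bad
base points. -/
theorem exists_ne_zero_ae_line_notMem (hN : volume N = 0) (hΨ : Continuous Ψ)
    {r : EuclideanSpace ℝ (Fin d)} (hr : Ψ r ≠ 0) (v : EuclideanSpace ℝ (Fin d)) :
    ∃ r₀, Ψ r₀ ≠ 0 ∧ ∀ᵐ t : ℝ, r₀ + t • v ∉ N := by
  have hopen : IsOpen {y | Ψ y ≠ 0} := isOpen_ne_fun hΨ continuous_const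
  have hpos : volume {y | Ψ y ≠ 0} ≠ 0 := (hopen.measure_pos volume ⟨r, hr⟩).ne'
  by_contra hcon
  push Not at hcon
  refine hpos (measure_mono_null ?_ (ae_iff.1 (ae_ae_line_notMem hN v)))
  intro y hy hy'
  exact hcon y hy hy'

theorem exists_finiteDimensional_translates (hγ : LinearIndependent ℝ γ)
    (hb : ∀ j, b j = primitiveDirection γ j) (hN : volume N = 0)
    (hVper : IsLatticePeriodic γ V) (hV : MemTensorCp γ 0 V)
    (hsol : IsSchrodingerSolution γ N V lam Ψ)
    (hΨ : ∀ r, Ψ r = ∏ l, ψ l (b.repr r l)) (hne : ∃ r, Ψ r ≠ 0) (k : Fin d) :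
    ∃ F : Submodule ℂ (ℝ → ℂ), FiniteDimensional ℂ F ∧
      ∀ n : ℤ, (fun t => ψ k (t + n * ‖γ k‖)) ∈ F := by
  obtain ⟨r', hr'⟩ := hne
  obtain ⟨r, hr, hae⟩ := exists_ne_zero_ae_line_notMem hN
    (continuous_of_factors hb hΨ hsol.1 hr') hr' (b k)
  obtain ⟨A, hA, B, C, hlap⟩ := exists_laplacian_along hΨ r k
  set R := ∏ l ∈ Finset.univ.erase k, ψ l (b.repr r l) with hRdef
  have hR : R ≠ 0 := by
    intro h
    apply hr
    rw [hΨ, ← Finset.mul_prod_erase _ _ (Finset.mem_univ k), ← hRdef, h, mul_zero]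
  have hAc : (A : ℂ) ≠ 0 := Complex.ofReal_ne_zero.2 hA
  set x := b.repr r k with hx
  set h : ℝ → ℂ := fun t => ψ k (x + t) with hh
  have hCp : MemCp 2 h := memCp_two_factor hb hΨ hsol.1 hr k
  -- The coefficients p and q come from solving the restricted equation for h'', after division by
  -- the nonzero `A * R`.
  let p : ℂ := -B / (A * R)
  let q : ℝ → ℂ := fun t => (2 * R / (A * R)) * V (r + t • b k) - (2 * lam * R + C) / (A * R)
  have hq : LocallyIntegrable q volume := by
    have h1 : MemCp 0 fun t => (2 * R / (A * R)) * V (r + t • b k) := by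
      refine MemCp.const_mul _ ?_
      rw [hb]
      exact hV k r
    exact h1.2.sub (locallyIntegrable_const _)
  have hder : deriv h = fun t => deriv (ψ k) (x + t) :=
    funext fun t => deriv_comp_const_add (ψ k) x t
  have hder2 : deriv (deriv h) = fun t => deriv (deriv (ψ k)) (x + t) := by
    rw [hder]
    exact funext fun t => deriv_comp_const_add (deriv (ψ k)) x t
  have hmem : h ∈ integratedSolutions p q hq := by
    refine hCp.mem_integratedSolutions hq ?_
    filter_upwards [hae] with t ht
    obtain ⟨h1, h2⟩ := hsol.2 _ ht
    rw [hlap t h1, hΨ, prod_eq_mul_prod_erase_along, ← hRdef, ← hx] at h2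
    rw [hder2, hder]
    simp only [p, q, hh]
    field_simp
    linear_combination (-2) * h2
  have hqper : ∀ (n : ℤ) (t : ℝ), q (t + n * ‖γ k‖) = q t := by
    intro n t
    have hmem : n • γ k ∈ bravaisLattice γ :=
      Submodule.smul_mem _ n (Submodule.subset_span ⟨k, rfl⟩)
    have : r + (t + n * ‖γ k‖) • b k = r + t • b k + n • γ k := by
      rw [add_smul, mul_smul, hb, norm_smul_primitiveDirection_eq hγ, add_assoc, Int.cast_smul_eq_zsmul]
    simp only [q]
    rw [this, hVper _ hmem]
  have := finiteDimensional_integratedSolutions (p := p) (q := q) (hq := hq)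
  -- The parameter t on the line starts at the base point; precomposition with `t - x` returns to
  -- the coordinate of `ψ k`.
  refine ⟨(integratedSolutions p q hq).map (LinearMap.funLeft ℂ ℂ fun t => t - x), inferInstance,
    fun n => ⟨_, translate_mem_integratedSolutions hmem (hqper n), ?_⟩⟩
  funext t
  simp only [LinearMap.funLeft_apply, hh]
  congr 1
  ring

/-- By multilinearity, products of members of finite spanning sets, one for each `F i`, already
span. -/
theorem finiteDimensional_span_products {ι X : Type*} [Fintype ι] (c : X → ι → ℝ)
    (F : ι → Submodule ℂ (ℝ → ℂ)) [∀ i, FiniteDimensional ℂ (F i)] :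
    FiniteDimensional ℂ (Submodule.span ℂ
      {f : X → ℂ | ∃ φ : ι → ℝ → ℂ, (∀ i, φ i ∈ F i) ∧ f = fun x => ∏ i, φ i (c x i)}) := by
  classical
  have hfg : ∀ i, ∃ s : Finset (ℝ → ℂ), Submodule.span ℂ (s : Set (ℝ → ℂ)) = F i := fun i =>
    (Submodule.fg_iff_finiteDimensional (F i)).2 inferInstance
  choose s hs using hfg
  let T : Set (X → ℂ) := (fun g : ι → ℝ → ℂ => fun x => ∏ i, g i (c x i)) ''
    (Fintype.piFinset s : Set (ι → ℝ → ℂ))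
  have hT : T.Finite := (Finset.finite_toSet _).image _
  have := FiniteDimensional.span_of_finite ℂ hT
  refine Submodule.finiteDimensional_of_le (S₂ := Submodule.span ℂ T) ?_
  rw [Submodule.span_le]
  rintro f ⟨φ, hφ, rfl⟩
  have hex : ∀ i, ∃ w : (ℝ → ℂ) → ℂ, ∑ g ∈ s i, w g • g = φ i := by
    intro i
    have := hφ i
    rw [← hs i, Submodule.mem_span_finset] at this
    obtain ⟨w, -, hw⟩ := this
    exact ⟨w, hw⟩
  choose w hw using hex
  have : (fun x => ∏ i, φ i (c x i)) = ∑ g ∈ Fintype.piFinset s,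
      (∏ i, w i (g i)) • fun x => ∏ i, g i (c x i) := by
    funext x
    simp only [← hw, Finset.sum_apply, Pi.smul_apply, smul_eq_mul]
    rw [Finset.prod_univ_sum]
    simp only [Finset.prod_mul_distrib]
  rw [SetLike.mem_coe, this]
  exact Submodule.sum_mem _ fun g hg =>
    Submodule.smul_mem _ _ (Submodule.subset_span ⟨g, hg, rfl⟩)

theorem exists_repr_eq_of_mem_bravaisLattice (hγ : LinearIndependent ℝ γ)
    (hb : ∀ j, b j = primitiveDirection γ j) {a : EuclideanSpace ℝ (Fin d)}
    (ha : a ∈ bravaisLattice γ) : ∃ n : Fin d → ℤ, ∀ l, b.repr a l = n l * ‖γ l‖ := by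
  obtain ⟨n, rfl⟩ := (Submodule.mem_span_range_iff_exists_fun ℤ).1 ha
  refine ⟨n, fun l => ?_⟩
  have : ∑ i, n i • γ i = ∑ i, (n i * ‖γ i‖) • b i := by
    refine Finset.sum_congr rfl fun i _ => ?_
    rw [mul_smul, hb, norm_smul_primitiveDirection_eq hγ, Int.cast_smul_eq_zsmul]
  rw [this, b.repr_sum_self]

theorem finiteDimensional_span_lattice_translates (hγ : LinearIndependent ℝ γ)
    (hN : volume N = 0) (hVper : IsLatticePeriodic γ V) (hV : MemTensorCp γ 0 V)
    (hsol : IsSchrodingerSolution γ N V lam Ψ) (hsep : IsSeparableAlong γ Ψ)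
    (hne : ∃ r, Ψ r ≠ 0) :
    FiniteDimensional ℂ (Submodule.span ℂ
      {f | ∃ a ∈ bravaisLattice γ, f = fun r => Ψ (r + a)}) := by
  obtain ⟨b, hb⟩ := exists_primitiveBasis hγ
  obtain ⟨ψ, hψ⟩ := hsep
  have hΨ : ∀ r, Ψ r = ∏ l, ψ l (b.repr r l) := by
    intro r
    rw [← hψ]
    simp only [← hb]
    rw [b.sum_repr]
  choose F hF hmem using
    exists_finiteDimensional_translates hγ hb hN hVper hV hsol hΨ hne
  have := finiteDimensional_span_products
    (fun (r : EuclideanSpace ℝ (Fin d)) (l : Fin d) => b.repr r l) F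
  refine Submodule.finiteDimensional_of_le (S₂ := Submodule.span ℂ
    {f | ∃ φ : Fin d → ℝ → ℂ, (∀ i, φ i ∈ F i) ∧ f = fun r => ∏ i, φ i (b.repr r i)})
    (Submodule.span_mono ?_)
  rintro f ⟨a, ha, rfl⟩
  obtain ⟨n, hn⟩ := exists_repr_eq_of_mem_bravaisLattice hγ hb ha
  refine ⟨fun l t => ψ l (t + n l * ‖γ l‖), fun l => hmem l (n l), ?_⟩
  funext r
  simp [hΨ, hn]

end Factors

/-! ### Bounded functions under commuting translations -/

section BoundedTranslation

variable {X : Type*} [AddCommGroup X] {g : X → ℂ} {a : X} {μ : ℂ}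

theorem apply_add_nsmul_of_quasiperiodic (h : ∀ r, g (r + a) = μ * g r) (r : X) (n : ℕ) :
    g (r + n • a) = μ ^ n * g r := by
  induction n with
  | zero => simp
  | succ n ih => rw [succ_nsmul, ← add_assoc, h, ih, pow_succ]; ring

/-- Iterating forwards from r excludes modulus above one; iterating up to r from `r - n • a`
excludes modulus below one. -/
theorem norm_multiplier_eq_one (hg : ∃ C : ℝ, ∀ r, ‖g r‖ ≤ C) (h : ∀ r, g (r + a) = μ * g r)
    {r : X} (hr : g r ≠ 0) : ‖μ‖ = 1 := by
  obtain ⟨C, hC⟩ := hg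
  have hpos : 0 < ‖g r‖ := norm_pos_iff.2 hr
  have hCpos : 0 < C := hpos.trans_le (hC r)
  refine le_antisymm ?_ ?_
  · by_contra! hlt
    obtain ⟨n, hn⟩ := pow_unbounded_of_one_lt (C / ‖g r‖) hlt
    have := hC (r + n • a)
    rw [apply_add_nsmul_of_quasiperiodic h, norm_mul, norm_pow] at this
    rw [div_lt_iff₀ hpos] at hn
    linarith
  · by_contra! hlt
    obtain ⟨n, hn⟩ := exists_pow_lt_of_lt_one (div_pos hpos hCpos) hlt
    have h1 := apply_add_nsmul_of_quasiperiodic h (r - n • a) n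
    rw [sub_add_cancel] at h1
    have h2 : ‖g r‖ ≤ ‖μ‖ ^ n * C := by
      rw [h1, norm_mul, norm_pow]
      gcongr
      exact hC _
    rw [lt_div_iff₀ hCpos] at hn
    linarith

/-- There is no Jordan block of size two: the defect w is itself bounded and quasiperiodic, so if w
is nonzero then |μ| = 1 and g grows linearly along multiples of a. -/
theorem quasiperiodic_of_generalized (hg : ∃ C : ℝ, ∀ r, ‖g r‖ ≤ C)
    (h : ∀ r, g (r + a + a) - μ * g (r + a) = μ * (g (r + a) - μ * g r)) (r : X) :
    g (r + a) = μ * g r := by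
  obtain ⟨C, hC⟩ := hg
  set w : X → ℂ := fun r => g (r + a) - μ * g r with hw
  have hwq : ∀ r, w (r + a) = μ * w r := h
  by_contra hne
  have hwr : w r ≠ 0 := sub_ne_zero.2 hne
  have hwb : ∃ C : ℝ, ∀ r, ‖w r‖ ≤ C := by
    refine ⟨C + ‖μ‖ * C, fun r => (norm_sub_le _ _).trans ?_⟩
    rw [norm_mul]
    gcongr <;> exact hC _
  have hμ : ‖μ‖ = 1 := norm_multiplier_eq_one hwb hwq hwr
  -- Both sides carry an extra factor μ, which avoids the exponent n - 1.
  have hform : ∀ n : ℕ, μ * g (r + n • a) = μ ^ (n + 1) * g r + n * μ ^ n * w r := by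
    intro n
    induction n with
    | zero => simp
    | succ n ih =>
      have h1 := apply_add_nsmul_of_quasiperiodic hwq r n
      have h2 : g (r + (n + 1) • a) = w (r + n • a) + μ * g (r + n • a) := by
        rw [succ_nsmul, ← add_assoc]
        simp [hw]
      rw [h2, h1, ih]
      push_cast
      ring
  have hpos : 0 < ‖w r‖ := norm_pos_iff.2 hwr
  obtain ⟨n, hn⟩ := exists_nat_gt (2 * C / ‖w r‖)
  rw [div_lt_iff₀ hpos] at hn
  have h3 : (n : ℂ) * μ ^ n * w r = μ * g (r + n • a) - μ ^ (n + 1) * g r := by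
    rw [hform]; ring
  have h4 : (n : ℝ) * ‖w r‖ ≤ C + C := by
    calc (n : ℝ) * ‖w r‖ = ‖(n : ℂ) * μ ^ n * w r‖ := by simp [hμ]
      _ ≤ ‖μ * g (r + n • a)‖ + ‖μ ^ (n + 1) * g r‖ := by rw [h3]; exact norm_sub_le _ _
      _ ≤ C + C := by
        simp only [norm_mul, norm_pow, hμ, one_pow, one_mul]
        exact add_le_add (hC _) (hC _)
  linarith

theorem apply_eq_zero_of_pow_apply_eq_zero {M : Type*} [AddCommGroup M] [Module ℂ M]
    {T : Module.End ℂ M} (hT : ∀ u, T (T u) = 0 → T u = 0) (k : ℕ) {v : M}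
    (hv : (T ^ k) v = 0) : T v = 0 := by
  induction k with
  | zero =>
    have : v = 0 := by simpa using hv
    rw [this, map_zero]
  | succ k ih =>
    cases k with
    | zero => simpa using hv
    | succ k =>
      apply ih
      rw [pow_succ', Module.End.mul_apply] at hv ⊢
      rw [pow_succ', Module.End.mul_apply] at hv
      exact hT _ hv

/-- Commuting operators on a finite-dimensional complex space have spanning joint generalized
eigenspaces. Boundedness makes the kernel of `(f j - χ j)²` equal to that of `f j - χ j`, so the
generalized eigenvectors are genuine. -/
theorem le_span_quasiperiodic {ι : Type*} (a : ι → X) (S : Submodule ℂ (X → ℂ))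
    [FiniteDimensional ℂ S] (hb : ∀ f ∈ S, ∃ C : ℝ, ∀ r, ‖f r‖ ≤ C)
    (hS : ∀ j, ∀ f ∈ S, (fun r => f (r + a j)) ∈ S) :
    S ≤ Submodule.span ℂ
      {f | f ∈ S ∧ ∃ χ : ι → ℂ, ∀ j r, f (r + a j) = χ j * f r} := by
  let T : ι → Module.End ℂ (X → ℂ) := fun j => LinearMap.funLeft ℂ ℂ fun r => r + a j
  let f : ι → Module.End ℂ S := fun j => (T j).restrict (hS j)
  have hf : ∀ j (v : S) r, (f j v : X → ℂ) r = (v : X → ℂ) (r + a j) := fun j v r => rfl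
  have hcomm : Pairwise fun i j => Commute (f i) (f j) := by
    intro i j _
    refine LinearMap.ext fun v => Subtype.ext (funext fun r => ?_)
    simp only [Module.End.mul_apply, hf]
    rw [add_right_comm]
  have htop := Module.End.iSup_iInf_maxGenEigenspace_eq_top_of_iSup_maxGenEigenspace_eq_top_of_commute
    f hcomm fun j => Module.End.iSup_maxGenEigenspace_eq_top (f j)
  intro v hv
  have hmem : (⟨v, hv⟩ : S) ∈ ⨆ χ : ι → ℂ, ⨅ j, (f j).maxGenEigenspace (χ j) := by
    rw [htop]; trivial
  suffices H : (⨆ χ : ι → ℂ, ⨅ j, (f j).maxGenEigenspace (χ j)) ≤ (Submodule.span ℂ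
      {f | f ∈ S ∧ ∃ χ : ι → ℂ, ∀ j r, f (r + a j) = χ j * f r}).comap S.subtype from H hmem
  refine iSup_le fun χ u hu => Submodule.subset_span ⟨u.2, χ, fun j r => ?_⟩
  obtain ⟨k, hk⟩ := (Module.End.mem_iInf_maxGenEigenspace_iff f χ u).1 hu j
  have hev : ∀ (u : S) r, ((f j - χ j • (1 : Module.End ℂ S)) u : X → ℂ) r =
      (u : X → ℂ) (r + a j) - χ j * (u : X → ℂ) r := fun u r => rfl
  have hz : (f j - χ j • (1 : Module.End ℂ S)) u = 0 := by
    refine apply_eq_zero_of_pow_apply_eq_zero (fun u hu => ?_) k hk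
    refine Subtype.ext (funext fun r => ?_)
    rw [hev]
    refine sub_eq_zero.2 (quasiperiodic_of_generalized (hb u u.2) (fun r => ?_) r)
    have := congrFun (congrArg Subtype.val hu) r
    rw [hev, hev, hev] at this
    exact sub_eq_zero.1 this
  have := congrFun (congrArg Subtype.val hz) r
  rw [hev] at this
  exact sub_eq_zero.1 this

end BoundedTranslation

/-! ### Multipliers and quasimomenta -/

section Bloch

variable {d : ℕ} {γ : Fin d → EuclideanSpace ℝ (Fin d)}

/-- The linear functional with prescribed values on the basis γ is represented by its values on the
standard basis. -/
theorem exists_inner_eq (hγ : LinearIndependent ℝ γ) (θ : Fin d → ℝ) :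
    ∃ k : Fin d → ℝ, ∀ j, ∑ i, k i * γ j i = θ j := by
  let bγ : Module.Basis (Fin d) ℝ (EuclideanSpace ℝ (Fin d)) :=
    Module.Basis.mk hγ (by
      rw [hγ.span_eq_top_of_card_eq_finrank' (by simp)])
  let L : EuclideanSpace ℝ (Fin d) →ₗ[ℝ] ℝ := bγ.constr ℝ θ
  refine ⟨fun i => L (EuclideanSpace.basisFun (Fin d) ℝ i), fun j => ?_⟩
  have h1 : L (γ j) = θ j := by
    have := bγ.constr_basis ℝ θ j
    rwa [Module.Basis.mk_apply] at this
  rw [← h1]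
  conv_rhs => rw [← (EuclideanSpace.basisFun (Fin d) ℝ).sum_repr (γ j), map_sum]
  simp [mul_comm]

theorem IsLatticePeriodic.of_generators {β : Type*} {p : EuclideanSpace ℝ (Fin d) → β}
    (h : ∀ j r, p (r + γ j) = p r) : IsLatticePeriodic γ p := by
  let H : AddSubgroup (EuclideanSpace ℝ (Fin d)) :=
    { carrier := {a | ∀ r, p (r + a) = p r}
      zero_mem' := fun r => by rw [add_zero]
      add_mem' := fun {a b} ha hb r => by rw [← add_assoc, hb, ha]
      neg_mem' := fun {a} ha r => by
        have := ha (r + -a)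
        rw [neg_add_cancel_right] at this
        exact this.symm }
  have : bravaisLattice γ ≤ H.toIntSubmodule := by
    refine Submodule.span_le.2 ?_
    rintro _ ⟨j, rfl⟩
    exact h j
  exact fun a ha => this ha

theorem sum_mul_add (k : Fin d → ℂ) (r a : EuclideanSpace ℝ (Fin d)) :
    ∑ i, k i * ((r + a) i : ℂ) = ∑ i, k i * (r i : ℂ) + ∑ i, k i * (a i : ℂ) := by
  simp [mul_add, Finset.sum_add_distrib]

/-- Choosing k with `k · γ j = arg (χ j)` makes the plane wave carry all the multipliers, so
dividing it out leaves a periodic function. -/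
theorem exists_bloch_form (hγ : LinearIndependent ℝ γ) {Φ : EuclideanSpace ℝ (Fin d) → ℂ}
    {χ : Fin d → ℂ} (hχ : ∀ j, ‖χ j‖ = 1) (h : ∀ j r, Φ (r + γ j) = χ j * Φ r) :
    ∃ k : Fin d → ℝ, ∃ p : EuclideanSpace ℝ (Fin d) → ℂ, IsLatticePeriodic γ p ∧
      ∀ r, Φ r = Complex.exp (Complex.I * ∑ i, (k i : ℂ) * (r i : ℂ)) * p r := by
  obtain ⟨k, hk⟩ := exists_inner_eq hγ fun j => (χ j).arg
  have hχk : ∀ j, χ j = Complex.exp (Complex.I * ∑ i, (k i : ℂ) * (γ j i : ℂ)) := by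
    intro j
    have h1 : ∑ i, (k i : ℂ) * (γ j i : ℂ) = ((χ j).arg : ℂ) := by
      rw [← hk j]; push_cast; rfl
    have h2 := Complex.norm_mul_exp_arg_mul_I (χ j)
    rw [hχ, Complex.ofReal_one, one_mul] at h2
    rw [h1, mul_comm, h2]
  refine ⟨k, fun r => Complex.exp (-(Complex.I * ∑ i, (k i : ℂ) * (r i : ℂ))) * Φ r,
    IsLatticePeriodic.of_generators fun j r => ?_, fun r => ?_⟩
  · simp only
    rw [h, sum_mul_add, hχk j, mul_add, neg_add, Complex.exp_add, Complex.exp_neg (_ * _),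
      Complex.exp_neg (_ * _)]
    field_simp [Complex.exp_ne_zero]
  · rw [← mul_assoc, ← Complex.exp_add, add_neg_cancel, Complex.exp_zero, one_mul]

/-- The multiplier of `γ j` has modulus `exp (-(Im k · γ j))`, which must be 1. Hence Im k is
orthogonal to a basis. -/
theorem im_quasimomentum_eq_zero (hγ : LinearIndependent ℝ γ)
    {Ψ : EuclideanSpace ℝ (Fin d) → ℂ} (hbdd : ∃ C : ℝ, ∀ r, ‖Ψ r‖ ≤ C) (hne : Ψ ≠ 0)
    {k : Fin d → ℂ} {p : EuclideanSpace ℝ (Fin d) → ℂ} (hp : IsLatticePeriodic γ p)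
    (hΨ : ∀ r, Ψ r = Complex.exp (Complex.I * ∑ i, k i * (r i : ℂ)) * p r) (i : Fin d) :
    (k i).im = 0 := by
  obtain ⟨r, hr⟩ := Function.ne_iff.1 hne
  have horth : ∀ j, ∑ i, (k i).im * γ j i = 0 := by
    intro j
    have hq : ∀ r, Ψ (r + γ j) =
        Complex.exp (Complex.I * ∑ i, k i * (γ j i : ℂ)) * Ψ r := by
      intro r
      rw [hΨ, hΨ, hp _ (Submodule.subset_span ⟨j, rfl⟩), sum_mul_add, mul_add, Complex.exp_add]
      ring
    have := norm_multiplier_eq_one hbdd hq hr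
    rw [Complex.norm_exp, Real.exp_eq_one_iff] at this
    simpa using this
  let L : EuclideanSpace ℝ (Fin d) →ₗ[ℝ] ℝ :=
    (EuclideanSpace.basisFun (Fin d) ℝ).toBasis.constr ℝ fun i => (k i).im
  have hLb : ∀ i, L (EuclideanSpace.basisFun (Fin d) ℝ i) = (k i).im := by
    intro i
    have := (EuclideanSpace.basisFun (Fin d) ℝ).toBasis.constr_basis ℝ (fun i => (k i).im) i
    rwa [OrthonormalBasis.coe_toBasis] at this
  have hL : L = 0 := by
    refine LinearMap.ext_on (hγ.span_eq_top_of_card_eq_finrank' (by simp)) ?_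
    rintro _ ⟨j, rfl⟩
    conv_lhs => rw [← (EuclideanSpace.basisFun (Fin d) ℝ).sum_repr (γ j), map_sum]
    simp only [map_smul, hLb]
    simpa [mul_comm] using horth j
  rw [← hLb, hL, LinearMap.zero_apply]

end Bloch

/-! ### The main theorem -/

theorem mainTheorem6 {d : ℕ} (γ : Fin d → EuclideanSpace ℝ (Fin d))
    (hγ : LinearIndependent ℝ γ)
    (N : Set (EuclideanSpace ℝ (Fin d))) (hN : volume N = 0)
    (hNper : IsLatticePeriodic γ (fun r => r ∈ N))
    (V : EuclideanSpace ℝ (Fin d) → ℂ) (hVper : IsLatticePeriodic γ V)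
    (hV : MemTensorCp γ 0 V) (lam : ℂ)
    (Ψ : EuclideanSpace ℝ (Fin d) → ℂ) (hΨ : IsSchrodingerSolution γ N V lam Ψ)
    (hsep : IsSeparableAlong γ Ψ) (hbdd : ∃ C : ℝ, ∀ r, ‖Ψ r‖ ≤ C) :
    Ψ ∈ Submodule.span ℂ {Φ : EuclideanSpace ℝ (Fin d) → ℂ |
        ∃ k : Fin d → ℝ, IsBlochSolution γ N V lam (fun i => (k i : ℂ)) Φ} ∧
      (Ψ ≠ 0 → ∀ k : Fin d → ℂ, IsBlochSolution γ N V lam k Ψ → ∀ i, (k i).im = 0) := by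
  refine ⟨?_, fun hne k hk i => by
    obtain ⟨-, p, hp, hform⟩ := hk
    exact im_quasimomentum_eq_zero hγ hbdd hne hp hform i⟩
  by_cases hne : Ψ = 0
  · rw [hne]
    exact Submodule.zero_mem _
  -- Elements of S need not be separable; separability serves only to make S finite-dimensional.
  set S : Submodule ℂ (EuclideanSpace ℝ (Fin d) → ℂ) := Submodule.span ℂ
    {f | ∃ a ∈ bravaisLattice γ, f = fun r => Ψ (r + a)} with hSdef
  have hfin : FiniteDimensional ℂ S :=
    finiteDimensional_span_lattice_translates hγ hN hVper hV hΨ hsep (Function.ne_iff.1 hne)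
  have hΨS : Ψ ∈ S := Submodule.subset_span ⟨0, Submodule.zero_mem _, by simp⟩
  have hsolS : ∀ f ∈ S, IsSchrodingerSolution γ N V lam f := by
    intro f hf
    refine isSchrodingerSolution_of_mem_span
      (S := {f | ∃ a ∈ bravaisLattice γ, f = fun r => Ψ (r + a)})
      ⟨_, 0, Submodule.zero_mem _, rfl⟩ ?_ hf
    rintro _ ⟨a, ha, rfl⟩
    exact hΨ.translate hNper hVper ha
  have hbS : ∀ f ∈ S, ∃ C : ℝ, ∀ r, ‖f r‖ ≤ C := by
    intro f hf
    induction hf using Submodule.span_induction with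
    | mem f hf =>
      obtain ⟨a, -, rfl⟩ := hf
      obtain ⟨C, hC⟩ := hbdd
      exact ⟨C, fun r => hC _⟩
    | zero => exact ⟨0, by simp⟩
    | add f g _ _ hf hg =>
      obtain ⟨C, hC⟩ := hf
      obtain ⟨C', hC'⟩ := hg
      exact ⟨C + C', fun r => norm_add_le_of_le (hC r) (hC' r)⟩
    | smul c f _ hf =>
      obtain ⟨C, hC⟩ := hf
      refine ⟨‖c‖ * C, fun r => ?_⟩
      rw [Pi.smul_apply, norm_smul]
      exact mul_le_mul_of_nonneg_left (hC r) (norm_nonneg c)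
  have hinv : ∀ j, ∀ f ∈ S, (fun r => f (r + γ j)) ∈ S := by
    intro j f hf
    have hle : S ≤ S.comap (LinearMap.funLeft ℂ ℂ fun r => r + γ j) := by
      refine Submodule.span_le.2 ?_
      rintro _ ⟨a, ha, rfl⟩
      refine Submodule.subset_span ⟨γ j + a,
        Submodule.add_mem _ (Submodule.subset_span ⟨j, rfl⟩) ha, ?_⟩
      funext r
      simp [LinearMap.funLeft_apply, add_assoc]
    exact hle hf
  -- It remains to show that each joint eigenvector in S is a Bloch solution with real
  -- quasimomentum.
  refine Submodule.span_le.2 ?_ (le_span_quasiperiodic γ S hbS hinv hΨS)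
  rintro f ⟨hf, χ, hχ⟩
  by_cases hf0 : f = 0
  · rw [hf0]
    exact Submodule.zero_mem _
  obtain ⟨r, hr⟩ := Function.ne_iff.1 hf0
  obtain ⟨k, hk⟩ := exists_bloch_form hγ
    (fun j => norm_multiplier_eq_one (hbS f hf) (hχ j) hr) hχ
  exact Submodule.subset_span ⟨k, hsolS f hf, hk⟩
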